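/- Let $\Gamma$ be a countable group acting by measurable transformations on a standard probability space $(B,\nu)$, and suppose the action is nonsingular (each $g\in\Gamma$ preserves the class of $\nu$-null sets); ergodicity is not assumed. Write $\frac{d\nu\circ g}{d\nu}$ for the Radon–Nikodym derivative of the measure $A\mapsto\nu(gA)$ with respect to $\nu$. The ratio set $RS(\Gamma\curvearrowright(B,\nu))\subset[0,\infty]$ is defined as follows. A real number $r\ge 0$ belongs to it if and only if for every measurable $A\subset B$ with $\nu(A)>0$ and every $\epsilon>0$ there are a measurable $A'\subset A$ with $\nu(A')>0$ and an element $g\in\Gamma\setminus\{e\}$ such that $gA'\subset A$ and $\left|\frac{d\nu\circ g}{d\nu}(b)-r\right|<\epsilon$ for every $b\in A'$. The point $\infty$ belongs to it if and only if for every such $A$ and every $n>0$ there are such $A'$ and $g$ with $gA'\subset A$ and $\frac{d\nu\circ g}{d\nu}(b)>n$ for every $b\in A'$. The stable ratio set is $$SRS(\Gamma\curvearrowright(B,\nu))=\bigcap RS(\Gamma\curvearrowright(B\times X,\nu\times\mu)),$$ the intersection being over all probability-measure-preserving actions of $\Gamma$ on standard probability spaces $(X,\mu)$, with $\Gamma$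 acting diagonally on $B\times X$. Call the action conservative if for every measurable $A\subset B$ with $\nu(A)>0$ there are infinitely many $g\in\Gamma$ with $\nu(A\cap g^{-1}A)>0$. (This holds, for instance, if almost every ergodic component of the action is non-atomic.) If the action is conservative, then the ratio set and the stable ratio set are each of one of the following forms: $$\{1\},\qquad \{0,1,\infty\},\qquad [0,\infty],\qquad \{0,\infty\}\cup\{\lambda^n:\ n\in\mathbb{Z}\}\ \text{ for some } \lambda\in(0,1).$$ Without conservativity, the ratio set is either empty or of one of these four forms, and the stable ratio set is either empty or of one of these four forms. -/

import Mathlib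

open MeasureTheory
open scoped ENNReal NNReal

noncomputable section

/-- The Radon-Nikodym derivative `d(ν ∘ g)/dν`, where `ν ∘ g` is the measure `A ↦ ν (g A)`,
that is, the push-forward of `ν` under `g⁻¹`. -/
def smulDeriv {Γ B : Type*} [Group Γ] [MulAction Γ B] [MeasurableSpace B]
    (ν : Measure B) (g : Γ) : B → ℝ≥0∞ :=
  (ν.map (fun b => g⁻¹ • b)).rnDeriv ν

/-- The ratio set of an action of `Γ` on `(B, ν)`, as a subset of `[0, ∞]`. For `r < ∞`, each
`A` of positive measure contains, for all `ε > 0`, some `A'` of positive measure with `g A' ⊆ A`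
and `|d(ν ∘ g)/dν - r| < ε` on `A'`, for some `g ≠ e`; for `r = ∞` the last condition is that
`d(ν ∘ g)/dν > n` on `A'`, for every given `n`. -/
def ratioSet (Γ : Type*) {B : Type*} [Group Γ] [MulAction Γ B] [MeasurableSpace B]
    (ν : Measure B) : Set ℝ≥0∞ :=
  {r | (r ≠ ∞ ∧ ∀ A : Set B, MeasurableSet A → 0 < ν A → ∀ ε : ℝ, 0 < ε →
          ∃ A' : Set B, A' ⊆ A ∧ MeasurableSet A' ∧ 0 < ν A' ∧
            ∃ g : Γ, g ≠ 1 ∧ (∀ b ∈ A', g • b ∈ A) ∧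
              ∀ b ∈ A', |(smulDeriv ν g b).toReal - r.toReal| < ε) ∨
       (r = ∞ ∧ ∀ A : Set B, MeasurableSet A → 0 < ν A → ∀ n : ℕ, 0 < n →
          ∃ A' : Set B, A' ⊆ A ∧ MeasurableSet A' ∧ 0 < ν A' ∧
            ∃ g : Γ, g ≠ 1 ∧ (∀ b ∈ A', g • b ∈ A) ∧
              ∀ b ∈ A', (n : ℝ≥0∞) < smulDeriv ν g b)}

/-- The stable ratio set: the intersection of the ratio sets of the diagonal actions on
`(B × X, ν × μ)` over all probability-measure-preserving actions of `Γ` on standard probability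
spaces `(X, μ)`. Every standard Borel space is isomorphic to one in `Type`, so letting `X` range
over `Type` loses nothing. -/
def stableRatioSet (Γ : Type*) {B : Type*} [Group Γ] [MulAction Γ B] [MeasurableSpace B]
    (ν : Measure B) : Set ℝ≥0∞ :=
  {r | ∀ (X : Type) [MeasurableSpace X] [StandardBorelSpace X] [MulAction Γ X]
      [MeasurableConstSMul Γ X] (μ : Measure X) [IsProbabilityMeasure μ]
      [SMulInvariantMeasure Γ X μ], r ∈ ratioSet Γ (ν.prod μ)}

/-- The action is conservative: every set of positive measure meets infinitely many of its
translates in positive measure. -/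
def IsConservativeAction (Γ : Type*) {B : Type*} [Group Γ] [MulAction Γ B] [MeasurableSpace B]
    (ν : Measure B) : Prop :=
  ∀ A : Set B, MeasurableSet A → 0 < ν A →
    {g : Γ | 0 < ν {b ∈ A | g • b ∈ A}}.Infinite

/-- `S` is `{1}`, `{0, 1, ∞}`, `[0, ∞]`, or `{0, ∞} ∪ {l ^ n : n ∈ ℤ}` for some `l ∈ (0, 1)`. -/
def IsRatioSetType (S : Set ℝ≥0∞) : Prop :=
  S = {1} ∨ S = {0, 1, ∞} ∨ S = Set.univ ∨
    ∃ l : ℝ≥0, 0 < l ∧ l < 1 ∧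
      S = {0, ∞} ∪ Set.range (fun n : ℤ => ((l ^ n : ℝ≥0) : ℝ≥0∞))

end

/-! ### The Radon–Nikodym cocycle. -/

section RatioSet

open Filter Topology

variable {Γ B : Type*} [Group Γ] [MeasurableSpace B] [MulAction Γ B]

/-! A closed subset of `[0, ∞]` that contains 1 and is stable under inversion and under products of
nonzero elements has one of the four forms, because the logarithms of its finite nonzero elements
form a closed subgroup of `ℝ` (`isRatioSetType_of_isClosed`). A ratio set is closed, and the cocycle
identity gives inverses and products, except that a product equal to 1 might come from composing two
returns into the identity, which the condition `g ≠ 1` forbids.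

So the crux is 1. Under conservativity, `one_mem_ratioSet` shows by a packing and Borel–Cantelli
argument that some nontrivial return has derivative close to 1. Conversely any `r ≠ 1` in the ratio
set forces conservativity (`isConservativeAction_of_ne_one`), so a nonempty ratio set always
contains 1.

For the stable set these properties pass to intersections. Conservativity passes to `B × X` because
it amounts to a.e. divergence of `∑ d(ν ∘ g)/dν`, and the derivative of the diagonal action depends
only on the `B` coordinate. -/

theorem measurable_smulDeriv (ν : Measure B) (g : Γ) : Measurable (smulDeriv ν g) :=
  Measure.measurable_rnDeriv _ _

variable [MeasurableConstSMul Γ B] {ν : Measure B} [IsProbabilityMeasure ν]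

theorem lintegral_smulDeriv_mul
    (hns : ∀ g : Γ, Measure.QuasiMeasurePreserving (fun b : B => g • b) ν ν) (g : Γ)
    {f : B → ℝ≥0∞} (hf : Measurable f) :
    ∫⁻ b, smulDeriv ν g b * f b ∂ν = ∫⁻ b, f (g⁻¹ • b) ∂ν := by
  unfold smulDeriv
  rw [lintegral_rnDeriv_mul (hns g⁻¹).absolutelyContinuous hf.aemeasurable,
    lintegral_map hf (measurable_const_smul _)]

theorem setLIntegral_smulDeriv
    (hns : ∀ g : Γ, Measure.QuasiMeasurePreserving (fun b : B => g • b) ν ν) (g : Γ)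
    {A : Set B} (hA : MeasurableSet A) :
    ∫⁻ b in A, smulDeriv ν g b ∂ν = ν ((fun b => g⁻¹ • b) ⁻¹' A) := by
  unfold smulDeriv
  rw [Measure.setLIntegral_rnDeriv (hns g⁻¹).absolutelyContinuous,
    Measure.map_apply (measurable_const_smul _) hA]

/-- Chain rule: over each measurable `A`, both sides integrate to `ν (h g A)`. -/
theorem smulDeriv_mul_ae
    (hns : ∀ g : Γ, Measure.QuasiMeasurePreserving (fun b : B => g • b) ν ν) (h g : Γ) :
    ∀ᵐ b ∂ν, smulDeriv ν (h * g) b = smulDeriv ν h (g • b) * smulDeriv ν g b := by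
  refine ae_eq_of_forall_setLIntegral_eq_of_sigmaFinite (measurable_smulDeriv ν _)
    (((measurable_smulDeriv ν h).comp (measurable_const_smul g)).mul
      (measurable_smulDeriv ν g)) fun A hA _ => ?_
  have hm : Measurable (A.indicator fun b => smulDeriv ν h (g • b)) :=
    ((measurable_smulDeriv ν h).comp (measurable_const_smul g)).indicator hA
  have key := lintegral_smulDeriv_mul hns g hm
  have hA' : MeasurableSet ((fun b : B => g⁻¹ • b) ⁻¹' A) := measurable_const_smul _ hA
  rw [setLIntegral_smulDeriv hns _ hA, ← lintegral_indicator hA]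
  calc ν ((fun b => (h * g)⁻¹ • b) ⁻¹' A)
      = ν ((fun b => h⁻¹ • b) ⁻¹' ((fun b => g⁻¹ • b) ⁻¹' A)) := by
        congr 1; ext b; simp [mul_smul]
    _ = ∫⁻ b, A.indicator (fun b => smulDeriv ν h (g • b)) (g⁻¹ • b) ∂ν := by
        rw [← setLIntegral_smulDeriv hns h hA', ← lintegral_indicator hA']
        congr 1; ext b
        by_cases hb : g⁻¹ • b ∈ A <;> simp [hb]
    _ = _ := by
        rw [← key]
        congr 1; ext b
        by_cases hb : b ∈ A <;> simp [hb, mul_comm]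

omit [MeasurableConstSMul Γ B] in
theorem smulDeriv_one_ae : ∀ᵐ b ∂ν, smulDeriv ν (1 : Γ) b = 1 := by
  have : ν.map (fun b : B => (1 : Γ)⁻¹ • b) = ν := by simp
  unfold smulDeriv
  rw [this]
  exact Measure.rnDeriv_self ν

/-- The pointwise identities satisfied by the Radon-Nikodym cocycle at almost every point. -/
structure IsCocyclePoint (Γ : Type*) {B : Type*} [Group Γ] [MulAction Γ B] [MeasurableSpace B]
    (ν : Measure B) (b : B) : Prop where
  map_mul : ∀ h g : Γ, smulDeriv ν (h * g) b = smulDeriv ν h (g • b) * smulDeriv ν g b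
  map_one : smulDeriv ν (1 : Γ) b = 1
  ne_top : ∀ g : Γ, smulDeriv ν g b ≠ ∞

namespace IsCocyclePoint

omit [MeasurableConstSMul Γ B] [IsProbabilityMeasure ν]

theorem inv_mul {b : B} (hb : IsCocyclePoint Γ ν b) (g : Γ) :
    smulDeriv ν g⁻¹ (g • b) * smulDeriv ν g b = 1 := by
  rw [← hb.map_mul, inv_mul_cancel, hb.map_one]

theorem ne_zero {b : B} (hb : IsCocyclePoint Γ ν b) (g : Γ) : smulDeriv ν g b ≠ 0 := by
  intro h
  simpa [h] using hb.inv_mul g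

theorem inv_apply {b : B} (hb : IsCocyclePoint Γ ν b) (g : Γ) :
    smulDeriv ν g⁻¹ (g • b) = (smulDeriv ν g b)⁻¹ :=
  ENNReal.eq_inv_of_mul_eq_one_left (hb.inv_mul g)

theorem div_apply {b : B} (hb : IsCocyclePoint Γ ν b) (h g : Γ) :
    smulDeriv ν (h * g⁻¹) (g • b) * smulDeriv ν g b = smulDeriv ν h b := by
  rw [← hb.map_mul, inv_mul_cancel_right]

end IsCocyclePoint

theorem ae_isCocyclePoint [Countable Γ]
    (hns : ∀ g : Γ, Measure.QuasiMeasurePreserving (fun b : B => g • b) ν ν) :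
    ∀ᵐ b ∂ν, IsCocyclePoint Γ ν b := by
  have h1 : ∀ᵐ b ∂ν, ∀ h g : Γ,
      smulDeriv ν (h * g) b = smulDeriv ν h (g • b) * smulDeriv ν g b :=
    ae_all_iff.2 fun h => ae_all_iff.2 fun g => smulDeriv_mul_ae hns h g
  have h2 : ∀ᵐ b ∂ν, ∀ g : Γ, smulDeriv ν g b < ∞ :=
    ae_all_iff.2 fun g => by unfold smulDeriv; exact Measure.rnDeriv_lt_top _ _
  filter_upwards [h1, h2, smulDeriv_one_ae (Γ := Γ) (ν := ν)] with b a1 a2 a3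
  exact ⟨a1, a3, fun g => (a2 g).ne⟩

omit [MeasurableConstSMul Γ B] [IsProbabilityMeasure ν] in
theorem measure_pos_of_smul_mem
    (hns : ∀ g : Γ, Measure.QuasiMeasurePreserving (fun b : B => g • b) ν ν) (g : Γ)
    {E F : Set B} (hE : 0 < ν E) (h : ∀ᵐ b ∂ν, b ∈ E → g • b ∈ F) : 0 < ν F := by
  rw [pos_iff_ne_zero] at hE ⊢
  intro hF
  refine hE (measure_eq_zero_iff_ae_notMem.2 ?_)
  filter_upwards [h, (hns g).ae (measure_eq_zero_iff_ae_notMem.1 hF)] with b h1 h2 h3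
  exact h2 (h1 h3)

omit [MeasurableConstSMul Γ B] [IsProbabilityMeasure ν] in
theorem measure_pos_of_ae_imp {E F : Set B} (hE : 0 < ν E) (h : ∀ᵐ b ∂ν, b ∈ E → b ∈ F) :
    0 < ν F :=
  hE.trans_le (measure_mono_ae h)

omit [MeasurableConstSMul Γ B] [IsProbabilityMeasure ν] in
theorem exists_mem_of_measure_pos {E : Set B} (hE : 0 < ν E) {p : B → Prop}
    (hp : ∀ᵐ b ∂ν, p b) : ∃ b, b ∈ E ∧ p b := by
  by_contra! h
  exact hE.ne' (measure_eq_zero_iff_ae_notMem.2 (hp.mono fun b hb hbE => h b hbE hb))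

/-! ### Topology of the ratio set, inverses and products. -/

/-- Every set of positive measure has a positive measure of points returning to it with
Radon-Nikodym derivative in `U`. -/
def IsEssentialRange (Γ : Type*) {B : Type*} [Group Γ] [MulAction Γ B] [MeasurableSpace B]
    (ν : Measure B) (U : Set ℝ≥0∞) : Prop :=
  ∀ A : Set B, MeasurableSet A → 0 < ν A →
    ∃ g : Γ, g ≠ 1 ∧ 0 < ν {b | b ∈ A ∧ g • b ∈ A ∧ smulDeriv ν g b ∈ U}

omit [IsProbabilityMeasure ν] in
theorem measurableSet_return {A : Set B} (hA : MeasurableSet A) (g : Γ) {U : Set ℝ≥0∞}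
    (hU : MeasurableSet U) :
    MeasurableSet {b | b ∈ A ∧ g • b ∈ A ∧ smulDeriv ν g b ∈ U} :=
  hA.inter ((measurable_const_smul g hA).inter (measurable_smulDeriv ν g hU))

/-- This form treats finite `r` and `∞` alike and makes closedness immediate. -/
theorem mem_ratioSet_iff (r : ℝ≥0∞) :
    r ∈ ratioSet Γ ν ↔ ∀ U, IsOpen U → r ∈ U → IsEssentialRange Γ ν U := by
  constructor
  · rintro (⟨hr, h⟩ | ⟨rfl, h⟩) U hU hrU A hA hpos
    · lift r to ℝ≥0 using hr
      have hn : ENNReal.ofReal ⁻¹' U ∈ 𝓝 (r : ℝ) :=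
        ENNReal.continuous_ofReal.continuousAt.preimage_mem_nhds
          (hU.mem_nhds (by simpa using hrU))
      obtain ⟨ε, hε, hball⟩ := Metric.mem_nhds_iff.1 hn
      obtain ⟨A', hA', -, hp, g, hg, hm, hd⟩ := h A hA hpos ε hε
      refine ⟨g, hg, measure_pos_of_ae_imp hp ?_⟩
      -- `toReal` sends `∞` to 0, so an infinite derivative could pass for a small one; finiteness
      -- a.e. rules this out.
      have hfin : ∀ᵐ b ∂ν, smulDeriv ν g b < ∞ := by
        unfold smulDeriv; exact Measure.rnDeriv_lt_top _ _
      filter_upwards [hfin] with b hb hbA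
      refine ⟨hA' hbA, hm b hbA, ?_⟩
      have := hball (a := (smulDeriv ν g b).toReal) (by
        simpa [Real.dist_eq] using hd b hbA)
      rwa [Set.mem_preimage, ENNReal.ofReal_toReal hb.ne] at this
    · obtain ⟨n, hn⟩ := ENNReal.nhds_top_basis.mem_iff.1 (hU.mem_nhds hrU)
      obtain ⟨m, hm⟩ := ENNReal.exists_nat_gt hn.1.ne
      obtain ⟨A', hA', -, hp, g, hg, hgm, hd⟩ := h A hA hpos (m + 1) m.succ_pos
      refine ⟨g, hg, hp.trans_le (measure_mono fun b hb => ⟨hA' hb, hgm b hb, hn.2 ?_⟩)⟩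
      refine hm.trans (lt_of_le_of_lt ?_ (hd b hb))
      exact_mod_cast Nat.le_succ m
  · intro h
    by_cases hr : r = ∞
    · refine Or.inr ⟨hr, fun A hA hpos n _ => ?_⟩
      subst hr
      obtain ⟨g, hg, hp⟩ := h (Set.Ioi (n : ℝ≥0∞)) isOpen_Ioi (by simp) A hA hpos
      exact ⟨_, fun b hb => hb.1, measurableSet_return hA g measurableSet_Ioi, hp, g, hg,
        fun b hb => hb.2.1, fun b hb => hb.2.2⟩
    · refine Or.inl ⟨hr, fun A hA hpos ε hε => ?_⟩
      have hn : ENNReal.toReal ⁻¹' Metric.ball r.toReal ε ∈ 𝓝 r :=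
        (ENNReal.tendsto_toReal hr) (Metric.ball_mem_nhds _ hε)
      obtain ⟨U, hUs, hU, hrU⟩ := mem_nhds_iff.1 hn
      obtain ⟨g, hg, hp⟩ := h U hU hrU A hA hpos
      refine ⟨_, fun b hb => hb.1, measurableSet_return hA g hU.measurableSet, hp, g, hg,
        fun b hb => hb.2.1, fun b hb => ?_⟩
      simpa [Real.dist_eq] using hUs hb.2.2

theorem isClosed_ratioSet : IsClosed (ratioSet Γ ν) := by
  refine isClosed_of_closure_subset fun r hr => (mem_ratioSet_iff r).2 fun U hU hrU => ?_
  obtain ⟨s, hsU, hs⟩ := mem_closure_iff.1 hr U hU hrU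
  exact (mem_ratioSet_iff s).1 hs U hU hsU

variable [Countable Γ]
  (hns : ∀ g : Γ, Measure.QuasiMeasurePreserving (fun b : B => g • b) ν ν)

include hns

theorem inv_mem_ratioSet {r : ℝ≥0∞} (hr : r ∈ ratioSet Γ ν) : r⁻¹ ∈ ratioSet Γ ν := by
  rw [mem_ratioSet_iff] at hr ⊢
  intro U hU hrU A hA hpos
  obtain ⟨g, hg, hp⟩ := hr (Inv.inv ⁻¹' U) (hU.preimage continuous_inv) hrU A hA hpos
  refine ⟨g⁻¹, inv_ne_one.2 hg, measure_pos_of_smul_mem hns g hp ?_⟩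
  filter_upwards [ae_isCocyclePoint hns] with b hb ⟨h1, h2, h3⟩
  refine ⟨h2, by simpa using h1, ?_⟩
  rw [hb.inv_apply]
  exact h3

/-- A return `g` on `E ⊆ A` is followed by a return `h` of the translate `g E` to itself. Nonzero
factors avoid `0 * ∞`, where multiplication is discontinuous. -/
theorem mul_mem_ratioSet {r s : ℝ≥0∞} (hr : r ∈ ratioSet Γ ν) (hs : s ∈ ratioSet Γ ν)
    (hr0 : r ≠ 0) (hs0 : s ≠ 0) (hone : r * s ≠ 1) :
    r * s ∈ ratioSet Γ ν := by
  rw [mem_ratioSet_iff] at hr hs ⊢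
  intro U hU hrU A hA hpos
  -- Removing 1 from the target guarantees `h * g ≠ 1`, since the identity has derivative 1.
  have hn : (fun p : ℝ≥0∞ × ℝ≥0∞ => p.1 * p.2) ⁻¹' (U ∩ {1}ᶜ) ∈ 𝓝 (r, s) :=
    ENNReal.tendsto_mul (Or.inl hr0) (Or.inl hs0)
      ((hU.inter isOpen_compl_singleton).mem_nhds ⟨hrU, hone⟩)
  obtain ⟨V, W, hV, hrV, hW, hsW, hVW⟩ := mem_nhds_prod_iff'.1 hn
  obtain ⟨g, -, hpg⟩ := hr V hV hrV A hA hpos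
  set E := {b | b ∈ A ∧ g • b ∈ A ∧ smulDeriv ν g b ∈ V} with hE
  have hEm : MeasurableSet E := measurableSet_return hA g hV.measurableSet
  have hgE : 0 < ν ((fun b : B => g⁻¹ • b) ⁻¹' E) :=
    measure_pos_of_smul_mem hns g hpg (ae_of_all _ fun b hb => by simpa using hb)
  obtain ⟨h, -, hph⟩ := hs W hW hsW _ (measurable_const_smul g⁻¹ hEm) hgE
  have hF : 0 < ν {b | b ∈ A ∧ (h * g) • b ∈ A ∧ smulDeriv ν (h * g) b ∈ U ∩ {1}ᶜ} := by
    refine measure_pos_of_smul_mem hns g⁻¹ hph ?_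
    filter_upwards [(hns g⁻¹).ae (ae_isCocyclePoint hns)] with c hc ⟨h1, h2, h3⟩
    have h4 : g • g⁻¹ • h • c ∈ A := h2.2.1
    refine ⟨h1.1, by simpa [mul_smul] using h4, ?_⟩
    rw [hc.map_mul, smul_inv_smul, mul_comm]
    exact hVW (Set.mk_mem_prod h1.2.2 h3)
  refine ⟨h * g, ?_, hF.trans_le (measure_mono fun b hb => ⟨hb.1, hb.2.1, hb.2.2.1⟩)⟩
  rintro hhg
  obtain ⟨b, hb⟩ := exists_mem_of_measure_pos hF (ae_isCocyclePoint hns)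
  exact hb.1.2.2.2 (by rw [hhg]; exact hb.2.map_one)

/-! ### Conservativity. -/

omit [Countable Γ] in
-- Suppose `A` has finitely many returning elements. Some `g ≠ 1` contracts a set `E` of returning
-- points, so `E \ g E` has positive measure. It is never returned to by `g`, hence has strictly
-- fewer returning elements: descent on their number.
theorem isConservativeAction_of_lt_one {r : ℝ≥0∞} (hr : r ∈ ratioSet Γ ν) (hlt : r < 1) :
    IsConservativeAction Γ ν := by
  obtain ⟨c, hrc, hc⟩ := exists_between hlt
  have hess := (mem_ratioSet_iff r).1 hr (Set.Iio c) isOpen_Iio hrc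
  intro A hA hpos
  by_contra hfin
  replace hfin := Set.not_infinite.1 hfin
  induction hn : hfin.toFinset.card using Nat.strong_induction_on generalizing A with
  | _ n ih =>
  obtain ⟨g, hg, hp⟩ := hess A hA hpos
  set E := {b | b ∈ A ∧ g • b ∈ A ∧ smulDeriv ν g b ∈ Set.Iio c} with hE
  have hEm : MeasurableSet E := measurableSet_return hA g measurableSet_Iio
  set G : Set B := (fun b => g⁻¹ • b) ⁻¹' E with hG
  have hGm : MeasurableSet G := measurable_const_smul g⁻¹ hEm
  have hlt' : ν G < ν E := by
    calc ν G = ∫⁻ b in E, smulDeriv ν g b ∂ν := (setLIntegral_smulDeriv hns g hEm).symm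
      _ ≤ ∫⁻ _ in E, c ∂ν := setLIntegral_mono measurable_const fun b hb => le_of_lt hb.2.2
      _ = c * ν E := by simp
      _ < 1 * ν E := by
        exact (ENNReal.mul_lt_mul_iff_left hp.ne' (measure_ne_top _ _)).2 hc
      _ = ν E := one_mul _
  have hC : 0 < ν (E \ G) := by
    refine lt_of_lt_of_le ?_ (le_measure_sdiff (μ := ν) (s₁ := E) (s₂ := G))
    exact tsub_pos_of_lt hlt'
  have hCA : E \ G ⊆ A := fun b hb => hb.1.1
  have hsub : {k : Γ | 0 < ν {b ∈ E \ G | k • b ∈ E \ G}} ⊆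
      {k : Γ | 0 < ν {b ∈ A | k • b ∈ A}} := fun k hk =>
    lt_of_lt_of_le (Set.mem_ofPred_eq ▸ hk)
      (measure_mono fun b hb => And.intro (hCA hb.1) (hCA hb.2))
  refine ih _ ?_ (E \ G) (hEm.diff hGm) hC (hfin.subset hsub) rfl
  rw [← hn]
  refine Finset.card_lt_card ((Finset.ssubset_iff_of_subset ?_).2 ⟨g, ?_, ?_⟩)
  · exact Set.Finite.toFinset_subset_toFinset.2 hsub
  · rw [Set.Finite.mem_toFinset]
    exact lt_of_lt_of_le hp (measure_mono fun b hb => ⟨hb.1, hb.2.1⟩)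
  · rw [Set.Finite.mem_toFinset, Set.mem_ofPred_eq, not_lt, nonpos_iff_eq_zero]
    convert measure_empty (μ := ν)
    refine Set.eq_empty_of_forall_notMem fun b hb => hb.2.2 ?_
    simpa [hG] using hb.1.1

theorem isConservativeAction_of_ne_one {r : ℝ≥0∞} (hr : r ∈ ratioSet Γ ν) (hne : r ≠ 1) :
    IsConservativeAction Γ ν := by
  rcases hne.lt_or_gt with h | h
  · exact isConservativeAction_of_lt_one hns hr h
  · exact isConservativeAction_of_lt_one hns (inv_mem_ratioSet hns hr)
      (ENNReal.inv_lt_one.2 h)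

omit [IsProbabilityMeasure ν] [MeasurableConstSMul Γ B] in
theorem ae_forall_smul {p : B → Prop} (hp : ∀ᵐ b ∂ν, p b) : ∀ᵐ b ∂ν, ∀ k : Γ, p (k • b) :=
  ae_all_iff.2 fun k => (hns k).ae hp

omit hns [IsProbabilityMeasure ν] in
-- The points of `A` returning only under a finite `F` form a set whose own returning elements lie
-- in `F`, hence a null set; there are countably many `F`.
theorem IsConservativeAction.ae_infinite (hcons : IsConservativeAction Γ ν) {A : Set B}
    (hA : MeasurableSet A) : ∀ᵐ b ∂ν, b ∈ A → {g : Γ | g • b ∈ A}.Infinite := by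
  have key : ∀ F : Finset Γ, ∀ᵐ b ∂ν, ¬ (b ∈ A ∧ ∀ g ∉ F, g • b ∉ A) := by
    intro F
    by_contra hF
    have hpos : 0 < ν {b | b ∈ A ∧ ∀ g ∉ F, g • b ∉ A} := by
      rw [pos_iff_ne_zero]
      exact fun h0 => hF (measure_eq_zero_iff_ae_notMem.1 h0)
    have hm : MeasurableSet {b | b ∈ A ∧ ∀ g ∉ F, g • b ∉ A} := by
      have : {b | b ∈ A ∧ ∀ g ∉ F, g • b ∉ A} =
          A ∩ ⋂ g : Γ, ⋂ _ : g ∉ F, ((fun b : B => g • b) ⁻¹' A)ᶜ := by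
        ext; simp
      rw [this]
      exact hA.inter (MeasurableSet.iInter fun g => MeasurableSet.iInter fun _ =>
        (measurable_const_smul g hA).compl)
    refine hcons _ hm hpos (F.finite_toSet.subset fun g hg => ?_)
    obtain ⟨b, hb, -⟩ := exists_mem_of_measure_pos hg (ae_of_all ν fun _ => trivial)
    by_contra hgF
    exact hb.1.2 g hgF hb.2.1
  filter_upwards [ae_all_iff.2 key] with b hb hbA hfin
  exact hb hfin.toFinset ⟨hbA, fun g hg => by simpa using hg⟩

theorem lintegral_tsum_smulDeriv {A : Set B} (hA : MeasurableSet A) :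
    ∫⁻ b in A, ∑' g : Γ, smulDeriv ν g b ∂ν = ∑' g : Γ, ν ((fun b => g⁻¹ • b) ⁻¹' A) := by
  rw [lintegral_tsum fun g => (measurable_smulDeriv ν g).aemeasurable]
  exact tsum_congr fun g => setLIntegral_smulDeriv hns g hA

/-- Where the sum is at most `M`, `∑ ν (g A)` is finite, and Borel–Cantelli contradicts infinite
recurrence. -/
theorem IsConservativeAction.tsum_smulDeriv_eq_top (hcons : IsConservativeAction Γ ν) :
    ∀ᵐ b ∂ν, ∑' g : Γ, smulDeriv ν g b = ∞ := by
  have key : ∀ M : ℕ, ∀ᵐ b ∂ν, ¬ ∑' g : Γ, smulDeriv ν g b ≤ M := by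
    intro M
    set A := {b | ∑' g : Γ, smulDeriv ν g b ≤ M} with hA
    have hAm : MeasurableSet A :=
      measurableSet_le (Measurable.tsum fun g => measurable_smulDeriv ν g)
        measurable_const
    have hsum : ∑' g : Γ, ν ((fun b => g⁻¹ • b) ⁻¹' A) ≠ ∞ := by
      rw [← lintegral_tsum_smulDeriv hns hAm]
      have hle : ∫⁻ b in A, ∑' g : Γ, smulDeriv ν g b ∂ν ≤ ∫⁻ _ in A, (M : ℝ≥0∞) ∂ν :=
        setLIntegral_mono measurable_const fun b hb => hb
      rw [setLIntegral_const] at hle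
      exact (hle.trans_lt (ENNReal.mul_lt_top (by simp) (measure_lt_top _ _))).ne
    filter_upwards [ae_finite_setOfPred_mem hsum, hcons.ae_infinite hAm] with b h1 h2 h3
    refine h2 h3 ((h1.image fun g => g⁻¹).subset fun g hg => ⟨g⁻¹, ?_, inv_inv g⟩)
    simpa using hg
  filter_upwards [ae_all_iff.2 key] with b hb
  by_contra h
  obtain ⟨M, hM⟩ := ENNReal.exists_nat_gt h
  exact hb M hM.le

/-- With finitely many returning elements `R`, almost every point lies in at most `R.card`
translates of `A`, so `∑ ν (g A)` is finite, whereas divergence makes it infinite. -/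
theorem isConservativeAction_of_tsum_eq_top (htop : ∀ᵐ b ∂ν, ∑' g : Γ, smulDeriv ν g b = ∞) :
    IsConservativeAction Γ ν := by
  intro A hA hpos
  by_contra hfin
  replace hfin := Set.not_infinite.1 hfin
  set R := hfin.toFinset with hR
  have h1 : ∀ᵐ b ∂ν, ∀ g ∉ R, b ∈ A → g • b ∉ A := by
    refine ae_all_iff.2 fun g => ?_
    by_cases hg : g ∈ R
    · simp [hg]
    · have : ν {b | b ∈ A ∧ g • b ∈ A} = 0 := by simpa [hR] using hg
      filter_upwards [measure_eq_zero_iff_ae_notMem.1 this] with b hb _ hbA hgA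
      exact hb ⟨hbA, hgA⟩
  have h2 : ∀ᵐ b ∂ν, ∑' g : Γ, ((fun b : B => g⁻¹ • b) ⁻¹' A).indicator 1 b ≤
      (R.card : ℝ≥0∞) := by
    filter_upwards [ae_forall_smul hns h1] with b hb
    by_cases hex : ∃ g : Γ, g⁻¹ • b ∈ A
    · obtain ⟨k, hk⟩ := hex
      -- Put `g = k * h⁻¹`: then `g⁻¹ • b = h • k⁻¹ • b` with `k⁻¹ • b ∈ A`, so only `h ∈ R`
      -- contribute.
      rw [← ((Equiv.inv Γ).trans (Equiv.mulLeft k)).tsum_eq]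
      have : ∀ h ∉ R, ((fun b : B => (((Equiv.inv Γ).trans (Equiv.mulLeft k)) h)⁻¹ • b) ⁻¹'
          A).indicator (1 : B → ℝ≥0∞) b = 0 := by
        intro h hh
        refine Set.indicator_of_notMem ?_ _
        simpa [mul_smul] using hb k⁻¹ h hh hk
      rw [tsum_eq_sum this]
      refine (Finset.sum_le_card_nsmul _ _ 1 fun h _ => ?_).trans (by simp)
      exact Set.indicator_le_self' (fun _ _ => zero_le) _ |>.trans (by simp)
    · push Not at hex
      have : ∀ g : Γ, ((fun b : B => g⁻¹ • b) ⁻¹' A).indicator (1 : B → ℝ≥0∞) b = 0 :=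
        fun g => Set.indicator_of_notMem (s := (fun b : B => g⁻¹ • b) ⁻¹' A) (hex g) _
      simp [this]
  have hm : ∀ g : Γ, MeasurableSet ((fun b : B => g⁻¹ • b) ⁻¹' A) :=
    fun g => measurable_const_smul g⁻¹ hA
  have h3 : ∑' g : Γ, ν ((fun b => g⁻¹ • b) ⁻¹' A) ≤ R.card := by
    calc ∑' g : Γ, ν ((fun b => g⁻¹ • b) ⁻¹' A)
        = ∫⁻ b, ∑' g : Γ, ((fun b : B => g⁻¹ • b) ⁻¹' A).indicator 1 b ∂ν := by
          rw [lintegral_tsum fun g => (measurable_one.indicator (hm g)).aemeasurable]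
          exact tsum_congr fun g => (lintegral_indicator_one (hm g)).symm
      _ ≤ ∫⁻ _, (R.card : ℝ≥0∞) ∂ν := lintegral_mono_ae h2
      _ = R.card := by simp
  rw [← lintegral_tsum_smulDeriv hns hA,
    setLIntegral_congr_fun_ae hA (htop.mono fun b hb _ => hb), setLIntegral_const,
    ENNReal.top_mul hpos.ne'] at h3
  exact absurd h3 (by simp)

/-! ### The element 1 of the ratio set. -/

omit hns [IsProbabilityMeasure ν] [MeasurableConstSMul Γ B] [Countable Γ] in
-- Packing: the intervals `(c * d i, d i]` are disjoint and lie in `(0, 1]`.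
theorem tsum_ofReal_mul_le_one {ι : Type*} [Countable ι] {d : ι → ℝ} {c : ℝ} (hc0 : 0 ≤ c)
    (hd0 : ∀ i, 0 ≤ d i) (hd1 : ∀ i, d i ≤ 1)
    (hsep : ∀ i j, i ≠ j → d i ≤ d j → d i ≤ c * d j) :
    ∑' i, ENNReal.ofReal (d i - c * d i) ≤ 1 := by
  have hdisj : Pairwise (Function.onFun Disjoint fun i => Set.Ioc (c * d i) (d i)) := by
    intro i j hij
    rw [Function.onFun, Set.disjoint_left]
    rintro t ⟨h1, h2⟩ ⟨h3, h4⟩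
    rcases le_total (d i) (d j) with h | h
    · linarith [hsep i j hij h]
    · linarith [hsep j i hij.symm h]
  calc ∑' i, ENNReal.ofReal (d i - c * d i)
      = ∑' i, volume (Set.Ioc (c * d i) (d i)) := by simp only [Real.volume_Ioc]
    _ = volume (⋃ i, Set.Ioc (c * d i) (d i)) :=
        (measure_iUnion hdisj fun _ => measurableSet_Ioc).symm
    _ ≤ volume (Set.Ioc (0 : ℝ) 1) := by
        refine measure_mono (Set.iUnion_subset fun i t ht => ⟨?_, ht.2.trans (hd1 i)⟩)
        exact (mul_nonneg hc0 (hd0 i)).trans_lt ht.1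
    _ = 1 := by simp

omit [IsProbabilityMeasure ν] [MeasurableConstSMul Γ B] hns in
/-- If no nontrivial return to `A` has derivative in `(c, 1]`, then the derivatives at most one
of the returns of a point are uniformly summable. -/
theorem tsum_return_le {A : Set B} {U : Set ℝ≥0∞} {c : ℝ≥0} (hc : c < 1)
    (hcU : Set.Ioc (c : ℝ≥0∞) 1 ⊆ U) {b : B} (hb : IsCocyclePoint Γ ν b)
    (hret : ∀ k g : Γ, g ≠ 1 → k • b ∈ A → g • k • b ∈ A → smulDeriv ν g (k • b) ∉ U) :
    ∑' g : Γ, {b | b ∈ A ∧ g • b ∈ A ∧ smulDeriv ν g b ∈ Set.Iic 1}.indicator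
      (smulDeriv ν g) b ≤ ((1 - c : ℝ≥0) : ℝ≥0∞)⁻¹ := by
  set F : Γ → Set B := fun g => {b | b ∈ A ∧ g • b ∈ A ∧ smulDeriv ν g b ∈ Set.Iic 1} with hF
  set d : Γ → ℝ≥0∞ := fun g => (F g).indicator (smulDeriv ν g) b with hd
  have hd1 : ∀ g, d g ≤ 1 := by
    intro g
    refine Set.indicator_apply_le' (fun h => h.2.2) fun _ => zero_le
  have hdt : ∀ g, d g ≠ ∞ := fun g => ((hd1 g).trans_lt ENNReal.one_lt_top).ne
  have hsep : ∀ g h, g ≠ h → d g ≤ d h → d g ≤ c * d h := by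
    intro g h hgh hle
    by_cases hg : b ∈ F g
    swap
    · have : d g = 0 := Set.indicator_of_notMem hg _
      simp [this]
    have hdg : d g = smulDeriv ν g b := Set.indicator_of_mem hg _
    by_cases hh : b ∈ F h
    swap
    · have : d h = 0 := Set.indicator_of_notMem hh _
      simpa [this] using hle
    have hdh : d h = smulDeriv ν h b := Set.indicator_of_mem hh _
    -- `g * h⁻¹` is a return from `h • b` to `g • b`, with derivative the ratio of the two; it is at
    -- most 1 and avoids `U`, hence at most `c`.
    have hnot := hret h (g * h⁻¹) (by rwa [Ne, mul_inv_eq_one]) hh.2.1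
      (by simpa [mul_smul] using hg.2.1)
    have hdiv := hb.div_apply g h
    rw [hdg, hdh] at hle ⊢
    rw [← hdiv]
    gcongr
    by_contra! hcon
    refine hnot (hcU ⟨hcon, ?_⟩)
    by_contra! h1
    rw [← hdiv] at hle
    refine absurd hle (not_le.2 ?_)
    simpa using (ENNReal.mul_lt_mul_iff_left (hb.ne_zero h) (hb.ne_top h)).2 h1
  have hreal := tsum_ofReal_mul_le_one (ι := Γ) (d := fun g => (d g).toReal) (c := c) c.2
    (fun g => ENNReal.toReal_nonneg)
    (fun g => by simpa using ENNReal.toReal_mono ENNReal.one_ne_top (hd1 g))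
    (fun g h hgh hle => by
      have := hsep g h hgh ((ENNReal.toReal_le_toReal (hdt g) (hdt h)).1 hle)
      simpa using ENNReal.toReal_mono (ENNReal.mul_ne_top (by simp) (hdt h)) this)
  have hterm : ∀ g, ENNReal.ofReal ((d g).toReal - c * (d g).toReal) =
      ((1 - c : ℝ≥0) : ℝ≥0∞) * d g := by
    intro g
    have : (d g).toReal - c * (d g).toReal = ((1 - c : ℝ≥0) : ℝ) * (d g).toReal := by
      rw [NNReal.coe_sub hc.le]; push_cast; ring
    rw [this, ENNReal.ofReal_mul NNReal.zero_le_coe, ENNReal.ofReal_coe_nnreal,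
      ENNReal.ofReal_toReal (hdt g)]
  simp_rw [hterm] at hreal
  rw [ENNReal.tsum_mul_left] at hreal
  rw [← one_div]
  refine ENNReal.le_div_iff_mul_le (Or.inl ?_) (Or.inl ENNReal.coe_ne_top) |>.2
    (by rwa [mul_comm])
  exact_mod_cast (tsub_pos_of_lt hc).ne'

theorem one_mem_ratioSet (hcons : IsConservativeAction Γ ν) : 1 ∈ ratioSet Γ ν := by
  rw [mem_ratioSet_iff]
  intro U hU h1U A hA hpos
  by_contra hcon
  simp only [not_exists, not_and, not_lt, nonpos_iff_eq_zero] at hcon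
  obtain ⟨c', hc', hcU⟩ := exists_Ioc_subset_of_mem_nhds (hU.mem_nhds h1U) ⟨0, zero_lt_one⟩
  lift c' to ℝ≥0 using (hc'.trans ENNReal.one_lt_top).ne with c
  have hc : c < 1 := by exact_mod_cast hc'
  have hret : ∀ᵐ b ∂ν, ∀ k g : Γ, g ≠ 1 → k • b ∈ A → g • k • b ∈ A →
      smulDeriv ν g (k • b) ∉ U := by
    refine ae_forall_smul hns (p := fun b => ∀ g : Γ, g ≠ 1 → b ∈ A → g • b ∈ A →
      smulDeriv ν g b ∉ U) (ae_all_iff.2 fun g => ?_)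
    by_cases hg : g = 1
    · simp [hg]
    · filter_upwards [measure_eq_zero_iff_ae_notMem.1 (hcon g hg)] with b hb _ h1 h2 h3
      exact hb ⟨h1, h2, h3⟩
  have hgood : ∀ᵐ b ∂ν, ∀ k : Γ, IsCocyclePoint Γ ν (k • b) :=
    ae_forall_smul hns (ae_isCocyclePoint hns)
  set F : Γ → Set B := fun g => {b | b ∈ A ∧ g • b ∈ A ∧ smulDeriv ν g b ∈ Set.Iic 1} with hF
  have hFm : ∀ g, MeasurableSet (F g) := fun g => measurableSet_return hA g measurableSet_Iic
  have hsum : ∑' g : Γ, ν ((fun b => g⁻¹ • b) ⁻¹' F g) ≠ ∞ := by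
    have hle : ∑' g : Γ, ν ((fun b => g⁻¹ • b) ⁻¹' F g) ≤ ((1 - c : ℝ≥0) : ℝ≥0∞)⁻¹ := by
      calc ∑' g : Γ, ν ((fun b => g⁻¹ • b) ⁻¹' F g)
          = ∫⁻ b, ∑' g : Γ, (F g).indicator (smulDeriv ν g) b ∂ν := by
            rw [lintegral_tsum fun g =>
              ((measurable_smulDeriv ν g).indicator (hFm g)).aemeasurable]
            refine tsum_congr fun g => ?_
            rw [lintegral_indicator (hFm g), setLIntegral_smulDeriv hns g (hFm g)]
        _ ≤ ∫⁻ _, ((1 - c : ℝ≥0) : ℝ≥0∞)⁻¹ ∂ν := by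
            refine lintegral_mono_ae ?_
            filter_upwards [hret, ae_isCocyclePoint hns] with b h1 h2
            exact tsum_return_le hc hcU h2 h1
        _ = ((1 - c : ℝ≥0) : ℝ≥0∞)⁻¹ := by simp
    refine (hle.trans_lt (ENNReal.inv_lt_top.2 ?_)).ne
    exact_mod_cast tsub_pos_of_lt hc
  -- Local maxima of the derivative along the part of an orbit in `A`. Almost every orbit meeting
  -- `A` contains one: Borel–Cantelli leaves finitely many returns with derivative at least 1, and a
  -- largest one leads into `A₁`.
  set A₁ : Set B := {b | b ∈ A ∧ ∀ g : Γ, g ≠ 1 → g • b ∈ A → smulDeriv ν g b < 1} with hA₁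
  have hA₁m : MeasurableSet A₁ := by
    have : A₁ = A ∩ ⋂ g : Γ, ⋂ _ : g ≠ 1,
        (((fun b : B => g • b) ⁻¹' A)ᶜ ∪ smulDeriv ν g ⁻¹' Set.Iio 1) := by
      ext; simp [hA₁, imp_iff_not_or]
    rw [this]
    exact hA.inter (MeasurableSet.iInter fun g => MeasurableSet.iInter fun _ =>
      (measurable_const_smul g hA).compl.union (measurable_smulDeriv ν g measurableSet_Iio))
  have hA₁pos : 0 < ν A₁ := by
    rw [pos_iff_ne_zero]
    intro h0
    obtain ⟨b, hbA, hfin, hcoc, hb, hnot⟩ := exists_mem_of_measure_pos hpos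
      ((ae_finite_setOfPred_mem hsum).and (hgood.and
        (hret.and (ae_forall_smul hns (measure_eq_zero_iff_ae_notMem.1 h0)))))
    have hfin' : {g : Γ | g • b ∈ A ∧ 1 ≤ smulDeriv ν g b}.Finite := by
      refine (hfin.image fun g => g⁻¹).subset fun g hg => ⟨g⁻¹, ?_, inv_inv g⟩
      have hb1 : IsCocyclePoint Γ ν b := by simpa using hcoc 1
      have : smulDeriv ν g⁻¹ (g • b) ≤ 1 := by
        rw [hb1.inv_apply]
        exact ENNReal.inv_le_one.2 hg.2
      exact ⟨by simpa using hg.1, by simpa using hbA, by simpa using this⟩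
    have hb1 : IsCocyclePoint Γ ν b := by simpa using hcoc 1
    obtain ⟨k, ⟨hkA, hk1⟩, hkmax⟩ := Set.exists_max_image _ (fun g => smulDeriv ν g b) hfin'
      ⟨1, by simpa using hbA, hb1.map_one.ge⟩
    refine hnot k ⟨hkA, fun g hg hgA => ?_⟩
    by_contra! hge
    have hmul := hb1.map_mul g k
    have hge' : smulDeriv ν k b ≤ smulDeriv ν (g * k) b := by
      rw [hmul]; exact le_mul_of_one_le_left zero_le hge
    have hle := hkmax (g * k) ⟨by simpa [mul_smul] using hgA, hk1.trans hge'⟩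
    have hle1 : smulDeriv ν g (k • b) ≤ 1 := by
      by_contra! h1
      rw [hmul] at hle
      refine absurd hle (not_le.2 ?_)
      simpa using (ENNReal.mul_lt_mul_iff_left (hb1.ne_zero k) (hb1.ne_top k)).2 h1
    exact hb k g hg hkA hgA (le_antisymm hle1 hge ▸ h1U)
  -- A nontrivial return of `A₁` to itself would make both a derivative and its inverse less than 1.
  obtain ⟨g, hg, hg1⟩ := (hcons A₁ hA₁m hA₁pos).exists_notMem_finite (Set.finite_singleton 1)
  obtain ⟨b, ⟨hbA, hgA⟩, hb⟩ := exists_mem_of_measure_pos hg (ae_isCocyclePoint hns)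
  have h1 := hbA.2 g hg1 hgA.1
  have h2 := hgA.2 g⁻¹ (inv_ne_one.2 hg1) (by simpa using hbA.1)
  rw [hb.inv_apply, ENNReal.inv_lt_one] at h2
  exact lt_asymm h1 h2

end RatioSet

/-! ### Closed multiplicative subsets of `[0, ∞]`. -/

section Classification

open Filter Topology

/-- The real numbers `x` with `exp x ∈ S` form a subgroup. -/
def logSubgroup (S : Set ℝ≥0∞) (hone : 1 ∈ S) (hinv : ∀ r ∈ S, r⁻¹ ∈ S)
    (hmul : ∀ r ∈ S, ∀ s ∈ S, r ≠ 0 → s ≠ 0 → r * s ∈ S) : AddSubgroup ℝ where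
  carrier := {x | ENNReal.ofReal (Real.exp x) ∈ S}
  zero_mem' := by simpa using hone
  add_mem' {x y} hx hy := by
    rw [Set.mem_ofPred_eq, Real.exp_add, ENNReal.ofReal_mul (Real.exp_pos x).le]
    exact hmul _ hx _ hy (by simp [Real.exp_pos]) (by simp [Real.exp_pos])
  neg_mem' {x} hx := by
    rw [Set.mem_ofPred_eq, Real.exp_neg, ENNReal.ofReal_inv_of_pos (Real.exp_pos x)]
    exact hinv _ hx

theorem ENNReal.eq_ofReal_exp_log {t : ℝ≥0∞} (h0 : t ≠ 0) (ht : t ≠ ∞) :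
    t = ENNReal.ofReal (Real.exp (Real.log t.toReal)) := by
  rw [Real.exp_log (ENNReal.toReal_pos h0 ht), ENNReal.ofReal_toReal ht]

/-- The log subgroup is dense, hence all of `ℝ` by closedness, or cyclic. A nontrivial element has
powers tending to `∞`, which brings in `∞` and 0; for the trivial subgroup, 0 and `∞` occur together
or not at all. -/
theorem isRatioSetType_of_isClosed {S : Set ℝ≥0∞} (hS : IsClosed S) (hone : 1 ∈ S)
    (hinv : ∀ r ∈ S, r⁻¹ ∈ S) (hmul : ∀ r ∈ S, ∀ s ∈ S, r ≠ 0 → s ≠ 0 → r * s ∈ S) :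
    IsRatioSetType S := by
  set G := logSubgroup S hone hinv hmul with hG
  have hmem : ∀ x : ℝ, x ∈ G ↔ ENNReal.ofReal (Real.exp x) ∈ S := fun x => Iff.rfl
  have hmem' : ∀ t : ℝ≥0∞, t ≠ 0 → t ≠ ∞ → (t ∈ S ↔ Real.log t.toReal ∈ G) := fun t h0 ht => by
    rw [hmem, ← ENNReal.eq_ofReal_exp_log h0 ht]
  have hzt : ∞ ∈ S → 0 ∈ S := fun h => by simpa using hinv _ h
  have htz : 0 ∈ S → ∞ ∈ S := fun h => by simpa using hinv _ h
  have htop : ∀ x ∈ G, 0 < x → ∞ ∈ S := by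
    intro x hx hpos
    have hlim : Tendsto (fun n : ℕ => ENNReal.ofReal (Real.exp (n • x))) atTop (𝓝 ∞) := by
      refine ENNReal.tendsto_ofReal_atTop.comp (Real.tendsto_exp_atTop.comp ?_)
      exact tendsto_id.atTop_nsmul_const hpos
    exact hS.mem_of_tendsto hlim (Eventually.of_forall fun n => G.nsmul_mem hx n)
  rcases G.dense_or_cyclic with hd | ⟨a, ha⟩
  · have hGc : IsClosed (G : Set ℝ) :=
      hS.preimage (ENNReal.continuous_ofReal.comp Real.continuous_exp)
    have huniv : ∀ x, x ∈ G := fun x => by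
      have := hGc.closure_eq ▸ hd x
      exact this
    have ht := htop 1 (huniv 1) one_pos
    refine Or.inr (Or.inr (Or.inl (Set.eq_univ_of_forall fun t => ?_)))
    by_cases h0 : t = 0
    · exact h0 ▸ hzt ht
    by_cases h1 : t = ∞
    · exact h1 ▸ ht
    exact (hmem' t h0 h1).2 (huniv _)
  have hGa : ∀ x, x ∈ G ↔ ∃ n : ℤ, n • a = x := fun x => by
    rw [ha, AddSubgroup.mem_closure_singleton]
  by_cases ha0 : a = 0
  · have hfin : ∀ t ∈ S, t ≠ 0 → t ≠ ∞ → t = 1 := by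
      intro t hts h0 h1
      obtain ⟨n, hn⟩ := (hGa _).1 ((hmem' t h0 h1).1 hts)
      rw [ENNReal.eq_ofReal_exp_log h0 h1, ← hn, ha0]
      simp
    by_cases h : 0 ∈ S
    · refine Or.inr (Or.inl (Set.Subset.antisymm (fun t hts => ?_) ?_))
      · by_cases h0 : t = 0
        · simp [h0]
        by_cases h1 : t = ∞
        · simp [h1]
        simp [hfin t hts h0 h1]
      · rintro t (rfl | rfl | rfl)
        exacts [h, hone, htz h]
    · refine Or.inl (Set.Subset.antisymm (fun t hts => ?_) (by simpa using hone))
      exact hfin t hts (fun h0 => h (h0 ▸ hts)) (fun h1 => h (hzt (h1 ▸ hts)))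
  · have hpos : 0 < |a| := abs_pos.2 ha0
    -- The generator is normalised to be negative, so that its exponential `l` is below 1.
    have hGabs : ∀ x, x ∈ G ↔ ∃ n : ℤ, n * -|a| = x := fun x => by
      rw [hGa]
      rcases abs_choice a with h | h <;> rw [h]
      · exact ⟨fun ⟨n, hn⟩ => ⟨-n, by simpa using hn⟩, fun ⟨n, hn⟩ => ⟨-n, by simpa using hn⟩⟩
      · simp
    have ht : ∞ ∈ S := htop |a| ((hGabs _).2 ⟨-1, by simp⟩) hpos
    set l : ℝ≥0 := (Real.exp (-|a|)).toNNReal with hldef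
    have hlc : (l : ℝ) = Real.exp (-|a|) := Real.coe_toNNReal _ (Real.exp_pos _).le
    have hl : ∀ n : ℤ, ((l ^ n : ℝ≥0) : ℝ≥0∞) = ENNReal.ofReal (Real.exp (n * -|a|)) := by
      intro n
      rw [mul_comm, Real.exp_mul, Real.rpow_intCast, ← hlc, ← NNReal.coe_zpow,
        ENNReal.ofReal_coe_nnreal]
    refine Or.inr (Or.inr (Or.inr ⟨l, Real.toNNReal_pos.2 (Real.exp_pos _), ?_,
      Set.Subset.antisymm (fun t hts => ?_) ?_⟩))
    · rw [← NNReal.coe_lt_coe, hlc, NNReal.coe_one, Real.exp_lt_one_iff]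
      exact neg_neg_of_pos hpos
    · by_cases h0 : t = 0
      · simp [h0]
      by_cases h1 : t = ∞
      · simp [h1]
      obtain ⟨n, hn⟩ := (hGabs _).1 ((hmem' t h0 h1).1 hts)
      refine Or.inr ⟨n, ?_⟩
      simp only [hl]
      rw [hn, ← ENNReal.eq_ofReal_exp_log h0 h1]
    · rintro t ((rfl | rfl) | ⟨n, rfl⟩)
      · exact hzt ht
      · exact ht
      · simp only [hl]
        exact (hGabs _).2 ⟨n, rfl⟩

end Classification

/-! ### Diagonal actions on `B × X`. -/

section Product

variable {Γ B X : Type*} [Group Γ] [MeasurableSpace B] [MulAction Γ B]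
  [MeasurableConstSMul Γ B] [MeasurableSpace X] [MulAction Γ X] [MeasurableConstSMul Γ X]
  {ν : Measure B} [IsProbabilityMeasure ν] {μ : Measure X} [IsProbabilityMeasure μ]
  [SMulInvariantMeasure Γ X μ]
  (hns : ∀ g : Γ, Measure.QuasiMeasurePreserving (fun b : B => g • b) ν ν)

instance measurableConstSMul_prod : MeasurableConstSMul Γ (B × X) where
  measurable_const_smul g :=
    (measurable_const_smul (α := B) g).prodMap (measurable_const_smul (α := X) g)

theorem map_smul_prod (g : Γ) :
    (ν.prod μ).map (fun p : B × X => g • p) = (ν.map fun b => g • b).prod μ := by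
  have h := Measure.map_prod_map ν μ (measurable_const_smul (α := B) g)
    (measurable_const_smul (α := X) g)
  rw [MeasureTheory.map_smul (μ := μ)] at h
  exact h.symm

include hns

theorem quasiMeasurePreserving_smul_prod (g : Γ) :
    Measure.QuasiMeasurePreserving (fun p : B × X => g • p) (ν.prod μ) (ν.prod μ) :=
  ⟨measurable_const_smul g, by
    rw [map_smul_prod]
    exact (hns g).absolutelyContinuous.prod Measure.AbsolutelyContinuous.rfl⟩

theorem smulDeriv_prod_ae (g : Γ) :
    ∀ᵐ p ∂(ν.prod μ), smulDeriv (ν.prod μ) g p = smulDeriv ν g p.1 := by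
  have h : (ν.prod μ).map (fun p : B × X => g⁻¹ • p) =
      (ν.prod μ).withDensity fun p => smulDeriv ν g p.1 := by
    rw [map_smul_prod, ← prod_withDensity_left (measurable_smulDeriv ν g), smulDeriv,
      Measure.withDensity_rnDeriv_eq _ _ (hns g⁻¹).absolutelyContinuous]
  unfold smulDeriv at h ⊢
  rw [h]
  exact Measure.rnDeriv_withDensity _ ((measurable_smulDeriv ν g).comp measurable_fst)

theorem IsConservativeAction.prod [Countable Γ] (hcons : IsConservativeAction Γ ν) :
    IsConservativeAction Γ (ν.prod μ) := by
  refine isConservativeAction_of_tsum_eq_top (quasiMeasurePreserving_smul_prod hns) ?_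
  filter_upwards [ae_all_iff.2 fun g => smulDeriv_prod_ae (μ := μ) hns g,
    Measure.quasiMeasurePreserving_fst.ae (hcons.tsum_smulDeriv_eq_top hns)] with p h1 h2
  simpa [h1] using h2

end Product

/-! ### Assembling the classification. -/

section Types

variable {Γ B : Type*} [Group Γ] [Countable Γ] [MeasurableSpace B] [MulAction Γ B]
  [MeasurableConstSMul Γ B] {ν : Measure B} [IsProbabilityMeasure ν]
  (hns : ∀ g : Γ, Measure.QuasiMeasurePreserving (fun b : B => g • b) ν ν)

include hns

theorem one_mem_ratioSet_of_mem {r : ℝ≥0∞} (hr : r ∈ ratioSet Γ ν) : 1 ∈ ratioSet Γ ν := by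
  by_cases h : r = 1
  · exact h ▸ hr
  · exact one_mem_ratioSet hns (isConservativeAction_of_ne_one hns hr h)

theorem mul_mem_ratioSet' {r s : ℝ≥0∞} (hr : r ∈ ratioSet Γ ν) (hs : s ∈ ratioSet Γ ν)
    (hr0 : r ≠ 0) (hs0 : s ≠ 0) : r * s ∈ ratioSet Γ ν := by
  by_cases h : r * s = 1
  · exact h ▸ one_mem_ratioSet_of_mem hns hr
  · exact mul_mem_ratioSet hns hr hs hr0 hs0 h

theorem isRatioSetType_ratioSet (hone : 1 ∈ ratioSet Γ ν) : IsRatioSetType (ratioSet Γ ν) :=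
  isRatioSetType_of_isClosed isClosed_ratioSet hone (fun _ h => inv_mem_ratioSet hns h)
    fun _ hr _ hs => mul_mem_ratioSet' hns hr hs

/-- Closedness, inverses and products are inherited by an intersection of ratio sets. -/
theorem isRatioSetType_stableRatioSet (hone : 1 ∈ stableRatioSet Γ ν) :
    IsRatioSetType (stableRatioSet Γ ν) := by
  refine isRatioSetType_of_isClosed (isClosed_of_closure_subset ?_) hone ?_ ?_
  · intro r hr X _ _ _ _ μ _ _
    have hsub : stableRatioSet Γ ν ⊆ ratioSet Γ (ν.prod μ) := fun s hs => hs X μ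
    exact isClosed_ratioSet.closure_subset (closure_mono hsub hr)
  · intro r hr X _ _ _ _ μ _ _
    exact inv_mem_ratioSet (quasiMeasurePreserving_smul_prod hns) (hr X μ)
  · intro r hr s hs hr0 hs0 X _ _ _ _ μ _ _
    exact mul_mem_ratioSet' (quasiMeasurePreserving_smul_prod hns) (hr X μ) (hs X μ) hr0 hs0

theorem one_mem_stableRatioSet (hcons : IsConservativeAction Γ ν) :
    1 ∈ stableRatioSet Γ ν := by
  intro X _ _ _ _ μ _ _
  exact one_mem_ratioSet (quasiMeasurePreserving_smul_prod hns) (hcons.prod hns)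

theorem one_mem_stableRatioSet_of_mem {r : ℝ≥0∞} (hr : r ∈ stableRatioSet Γ ν) :
    1 ∈ stableRatioSet Γ ν := by
  intro X _ _ _ _ μ _ _
  exact one_mem_ratioSet_of_mem (quasiMeasurePreserving_smul_prod hns) (hr X μ)

end Types

theorem mainTheorem6 {Γ B : Type*} [Group Γ] [Countable Γ]
    [MeasurableSpace B] [StandardBorelSpace B] [MulAction Γ B] [MeasurableConstSMul Γ B]
    (ν : Measure B) [IsProbabilityMeasure ν]
    (hns : ∀ g : Γ, Measure.QuasiMeasurePreserving (fun b : B => g • b) ν ν) :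
    (IsConservativeAction Γ ν →
      IsRatioSetType (ratioSet Γ ν) ∧ IsRatioSetType (stableRatioSet Γ ν)) ∧
    (ratioSet Γ ν = ∅ ∨ IsRatioSetType (ratioSet Γ ν)) ∧
    (stableRatioSet Γ ν = ∅ ∨ IsRatioSetType (stableRatioSet Γ ν)) := by
  refine ⟨fun hcons => ⟨isRatioSetType_ratioSet hns (one_mem_ratioSet hns hcons),
    isRatioSetType_stableRatioSet hns (one_mem_stableRatioSet hns hcons)⟩, ?_, ?_⟩
  · refine (ratioSet Γ ν).eq_empty_or_nonempty.imp_right fun ⟨r, hr⟩ => ?_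
    exact isRatioSetType_ratioSet hns (one_mem_ratioSet_of_mem hns hr)
  · refine (stableRatioSet Γ ν).eq_empty_or_nonempty.imp_right fun ⟨r, hr⟩ => ?_
    exact isRatioSetType_stableRatioSet hns (one_mem_stableRatioSet_of_mem hns hr)
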